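/- Let $\mathcal A$ be an abelian category with enough projectives and enough injectives. Let $\mathcal X\subseteq\mathcal A$ be a full subcategory, closed under isomorphisms and finite direct sums, which is functorially finite (every object of $\mathcal A$ has a right and a left $\mathcal X$-approximation), contains all projective and all injective objects of $\mathcal A$, and is closed under kernels of epimorphisms and cokernels of monomorphisms (equivalently, $\mathcal X$ is functorially finite, resolving and coresolving). Let $\underline{\mathcal X}$ (resp. $\overline{\mathcal X}$) be the category with the same objects as $\mathcal X$ whose morphisms are the morphisms of $\mathcal X$ modulo those that factor through a projective (resp. injective) object of $\mathcal A$. (i)(1) If idempotents split in $\underline{\mathcal X}$, then for every $A\in\mathcal X$ and every direct summand $F$ of the functor $\mathrm{Ext}^1_{\mathcal A}(A,-)|_{\mathcal X}:\mathcal X\to\mathrm{Ab}$ there is $B\in\mathcal X$ with $F\cong\mathrm{Ext}^1_{\mathcal A}(B,-)|_{\mathcal X}$. (ii)(1) If idempotents split in $\overline{\mathcal X}$, then for every $A\in\mathcal X$ and every direct summand $F$ of the functor $\mathrm{Ext}^1_{\mathcal A}(-,A)|_{\mathcal X}:\mathcal X^{\mathrm{op}}\to\mathrm{Ab}$ there is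 $B\in\mathcal X$ with $F\cong\mathrm{Ext}^1_{\mathcal A}(-,B)|_{\mathcal X}$. (i)(2), (ii)(2) In particular, if $\mathcal A$ is Krull–Schmidt (every object is a finite direct sum of objects with local endomorphism rings), then Auslander's conjecture and its dual hold for $\mathcal A$: for every $A\in\mathcal A$, every direct summand of $\mathrm{Ext}^1_{\mathcal A}(A,-)$ is isomorphic to $\mathrm{Ext}^1_{\mathcal A}(B,-)$ for some $B\in\mathcal A$, and every direct summand of $\mathrm{Ext}^1_{\mathcal A}(-,A)$ is isomorphic to $\mathrm{Ext}^1_{\mathcal A}(-,B)$ for some $B\in\mathcal A$. -/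

import Mathlib

open CategoryTheory CategoryTheory.Limits CategoryTheory.Abelian

universe v u

namespace AuslanderExt

section General

variable {C : Type u} [Category.{v} C]

/-- The morphism `f` factors through a projective object. -/
def FactorsThroughProjective {X Y : C} (f : X ⟶ Y) : Prop :=
  ∃ (Q : C) (_ : Projective Q) (a : X ⟶ Q) (b : Q ⟶ Y), a ≫ b = f

/-- The morphism `f` factors through an injective object. -/
def FactorsThroughInjective {X Y : C} (f : X ⟶ Y) : Prop :=
  ∃ (J : C) (_ : Injective J) (a : X ⟶ J) (b : J ⟶ Y), a ≫ b = f

/-- `φ : X ⟶ A` is a right `P`-approximation of `A`: `X` is in `P` and `Hom(-, X) ⟶ Hom(-, A)`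
is surjective on objects of `P`. -/
def IsRightApproximation (P : ObjectProperty C) {X A : C} (φ : X ⟶ A) : Prop :=
  P X ∧ ∀ (X' : C), P X' → Function.Surjective fun g : X' ⟶ X => g ≫ φ

/-- `φ : A ⟶ X` is a left `P`-approximation of `A`: `X` is in `P` and `Hom(X, -) ⟶ Hom(A, -)`
is surjective on objects of `P`. -/
def IsLeftApproximation (P : ObjectProperty C) {A X : C} (φ : A ⟶ X) : Prop :=
  P X ∧ ∀ (X' : C), P X' → Function.Surjective fun g : X ⟶ X' => φ ≫ g

/-- Every object has a right `P`-approximation. -/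
def IsContravariantlyFinite (P : ObjectProperty C) : Prop :=
  ∀ A : C, ∃ (X : C) (φ : X ⟶ A), IsRightApproximation P φ

/-- Every object has a left `P`-approximation. -/
def IsCovariantlyFinite (P : ObjectProperty C) : Prop :=
  ∀ A : C, ∃ (X : C) (φ : A ⟶ X), IsLeftApproximation P φ

/-- Both contravariantly and covariantly finite. -/
def IsFunctoriallyFinite (P : ObjectProperty C) : Prop :=
  IsContravariantlyFinite P ∧ IsCovariantlyFinite P

/-- `F` is a direct summand of `E`. -/
def IsDirectSummand [HasZeroMorphisms C] [HasBinaryBiproducts C] (F E : C) : Prop :=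
  ∃ G : C, Nonempty (E ≅ F ⊞ G)

end General

section AbelianCategory

open scoped ZeroObject

variable {A : Type u} [Category.{v} A] [Abelian A]

/-- A full subcategory (given by its objects), closed under isomorphisms and finite direct sums,
which is functorially finite, contains all projective and all injective objects, and is closed
under kernels of epimorphisms and cokernels of monomorphisms. The empty direct sum needs no
separate clause: a zero object is projective. -/
structure IsAdmissible (P : ObjectProperty A) : Prop where
  iso_closed : P.IsClosedUnderIsomorphisms
  biprod_mem : ∀ X Y : A, P X → P Y → P (X ⊞ Y)
  functoriallyFinite : IsFunctoriallyFinite P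
  projective_mem : ∀ Q : A, Projective Q → P Q
  injective_mem : ∀ J : A, Injective J → P J
  kernel_mem : ∀ (X Y : A) (f : X ⟶ Y), Epi f → P X → P Y → P (kernel f)
  cokernel_mem : ∀ (X Y : A) (f : X ⟶ Y), Mono f → P X → P Y → P (cokernel f)

/-- Two morphisms of the full subcategory are identified when their difference factors through a
projective object of `A`. -/
def stableRel (P : ObjectProperty A) : HomRel P.FullSubcategory :=
  fun _ _ f g => FactorsThroughProjective (f.hom - g.hom)

/-- Two morphisms of the full subcategory are identified when their difference factors through an
injective object of `A`. -/
def costableRel (P : ObjectProperty A) : HomRel P.FullSubcategory :=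
  fun _ _ f g => FactorsThroughInjective (f.hom - g.hom)

instance stableRel_congruence (P : ObjectProperty A) : Congruence (stableRel P) where
  comp_left := by
    rintro X Y Z f g g' ⟨Q, hQ, a, b, h⟩
    exact ⟨Q, hQ, f.hom ≫ a, b, by simp [h]⟩
  comp_right := by
    rintro X Y Z f f' g ⟨Q, hQ, a, b, h⟩
    exact ⟨Q, hQ, a, b ≫ g.hom, by simp [reassoc_of% h]⟩
  equivalence :=
    { refl := fun f => ⟨0, inferInstance, 0, 0, by simp⟩
      symm := by
        rintro f g ⟨Q, hQ, a, b, h⟩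
        exact ⟨Q, hQ, a, -b, by simp [h]⟩
      trans := by
        rintro f g k ⟨Q, hQ, a, b, h⟩ ⟨Q', hQ', a', b', h'⟩
        exact ⟨Q ⊞ Q', inferInstance, biprod.lift a a', biprod.desc b b', by
          simp [biprod.lift_desc, h, h']⟩ }

instance costableRel_congruence (P : ObjectProperty A) : Congruence (costableRel P) where
  comp_left := by
    rintro X Y Z f g g' ⟨J, hJ, a, b, h⟩
    exact ⟨J, hJ, f.hom ≫ a, b, by simp [h]⟩
  comp_right := by
    rintro X Y Z f f' g ⟨J, hJ, a, b, h⟩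
    exact ⟨J, hJ, a, b ≫ g.hom, by simp [reassoc_of% h]⟩
  equivalence :=
    { refl := fun f => ⟨0, inferInstance, 0, 0, by simp⟩
      symm := by
        rintro f g ⟨J, hJ, a, b, h⟩
        exact ⟨J, hJ, a, -b, by simp [h]⟩
      trans := by
        rintro f g k ⟨J, hJ, a, b, h⟩ ⟨J', hJ', a', b', h'⟩
        exact ⟨J ⊞ J', inferInstance, biprod.lift a a', biprod.desc b b', by
          simp [biprod.lift_desc, h, h']⟩ }

/-- The stable category of a full subcategory: the same objects, and morphisms of `A` modulo those
that factor through a projective object. -/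
abbrev StableCategory (P : ObjectProperty A) : Type u :=
  CategoryTheory.Quotient (stableRel P)

/-- The costable category of a full subcategory: the same objects, and morphisms of `A` modulo
those that factor through an injective object. -/
abbrev CostableCategory (P : ObjectProperty A) : Type u :=
  CategoryTheory.Quotient (costableRel P)

variable (A) in
/-- Every object is a finite direct sum of objects with local endomorphism rings. -/
def IsKrullSchmidt : Prop :=
  haveI : HasFiniteBiproducts A := Abelian.hasFiniteBiproducts
  ∀ X : A, ∃ (n : ℕ) (Y : Fin n → A),
    (∀ i, IsLocalRing (End (Y i))) ∧ Nonempty (X ≅ ⨁ Y)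

/-- The functor `Ext¹(X, -)` on `A`. -/
noncomputable def extFrom [EnoughProjectives A] (X : A) : A ⥤ AddCommGrpCat.{v} :=
  haveI : HasExt.{v} A := hasExt_of_enoughProjectives.{v} A
  (extFunctor (C := A) 1).obj (Opposite.op X)

/-- The functor `Ext¹(-, X)` on `A`. -/
noncomputable def extTo [EnoughProjectives A] (X : A) : Aᵒᵖ ⥤ AddCommGrpCat.{v} :=
  haveI : HasExt.{v} A := hasExt_of_enoughProjectives.{v} A
  (extFunctor (C := A) 1).flip.obj X

/-- The functor `Ext¹(X, -)` restricted to a full subcategory. -/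
noncomputable def extFromRestrict [EnoughProjectives A] (P : ObjectProperty A) (X : A) :
    P.FullSubcategory ⥤ AddCommGrpCat.{v} :=
  P.ι ⋙ extFrom X

/-- The functor `Ext¹(-, X)` restricted to a full subcategory. -/
noncomputable def extToRestrict [EnoughProjectives A] (P : ObjectProperty A) (X : A) :
    P.FullSubcategoryᵒᵖ ⥤ AddCommGrpCat.{v} :=
  P.ι.op ⋙ extTo X

variable (A) in
/-- Auslander's conjecture for `A`: every direct summand of a functor `Ext¹(X, -)` is isomorphic to
some `Ext¹(B, -)`. -/
def AuslanderConjecture [EnoughProjectives A] : Prop :=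
  ∀ (X : A) (F : A ⥤ AddCommGrpCat.{v}), IsDirectSummand F (extFrom X) →
    ∃ B : A, Nonempty (F ≅ extFrom B)

variable (A) in
/-- The dual of Auslander's conjecture for `A`: every direct summand of a functor `Ext¹(-, X)` is
isomorphic to some `Ext¹(-, B)`. -/
def DualAuslanderConjecture [EnoughProjectives A] : Prop :=
  ∀ (X : A) (F : Aᵒᵖ ⥤ AddCommGrpCat.{v}), IsDirectSummand F (extTo X) →
    ∃ B : A, Nonempty (F ≅ extTo B)

end AbelianCategory

end AuslanderExt

/-! Hilton–Rees: on an admissible subcategory, `X ↦ Ext¹(X, -)` is full, and it identifies exactly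
the morphisms whose difference factors through a projective (`full_restrictedExtFrom`,
`stableRel_iff`). Both facts come from a short exact sequence `K ⟶ Q ⟶ Y` with `Q` projective:
closure under kernels of epimorphisms keeps `K` in the subcategory, and since `Ext¹(Q, -) = 0` the
extension class in `Ext¹(Y, K)` generates `Ext¹(Y, -)`. A direct summand is thus an idempotent of
the stable category, and a splitting there gives the representing object
(`exists_iso_obj_of_retract`). Injectives and cokernels give the dual.

In the Krull–Schmidt case the subcategory is all of `A`. Finite sums of objects with local
endomorphism rings have the exchange property, so idempotents modulo an ideal lift to idempotents of
`A`, which split because `A` is abelian. -/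

namespace AuslanderExt

/-! ### Retracts of objects in the image of a full functor -/

section Retract

variable {C : Type*} [Category* C] {D : Type*} [Category* D]

/-- If the full functor `Φ` identifies exactly the morphisms related by `r` and idempotents split
in the quotient by `r`, then every retract of an object `Φ.obj X` is isomorphic to some
`Φ.obj B`. -/
theorem exists_iso_obj_of_retract (Φ : C ⥤ D) [Φ.Full] (r : HomRel C) [Congruence r]
    (hr : ∀ {X Y : C} (f g : X ⟶ Y), r f g ↔ Φ.map f = Φ.map g)
    [IsIdempotentComplete (Quotient r)] {F : D} {X : C} (h : Retract F (Φ.obj X)) :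
    ∃ B : C, Nonempty (F ≅ Φ.obj B) := by
  -- The retract is encoded by the idempotent `h.r ≫ h.i`; a preimage `f` need only be idempotent
  -- modulo `r`.
  obtain ⟨f, hf⟩ := Φ.map_surjective (h.r ≫ h.i)
  have hff : (Quotient.functor r).map f ≫ (Quotient.functor r).map f =
      (Quotient.functor r).map f := by
    rw [← Functor.map_comp, Quotient.functor_map_eq_iff, hr, Functor.map_comp, hf]
    simp
  obtain ⟨⟨B⟩, i, e, hie, hei⟩ := IsIdempotentComplete.idempotents_split _ _ hff
  obtain ⟨i, rfl⟩ := (Quotient.functor r).map_surjective (X := B) (Y := X) i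
  obtain ⟨e, rfl⟩ := (Quotient.functor r).map_surjective (X := X) (Y := B) e
  have hie' : Φ.map i ≫ Φ.map e = 𝟙 _ := by
    rw [← Φ.map_comp, ← Φ.map_id, ← hr, ← Quotient.functor_map_eq_iff r]
    exact (Functor.map_comp _ _ _).trans (hie.trans ((Quotient.functor r).map_id B).symm)
  have hei' : Φ.map e ≫ Φ.map i = h.r ≫ h.i := by
    rw [← hf, ← Φ.map_comp, ← hr, ← Quotient.functor_map_eq_iff r]
    exact (Functor.map_comp _ _ _).trans hei
  refine ⟨B, ⟨⟨h.i ≫ Φ.map e, Φ.map i ≫ h.r, ?_, ?_⟩⟩⟩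
  · simp [reassoc_of% hei']
  · calc (Φ.map i ≫ h.r) ≫ h.i ≫ Φ.map e = Φ.map i ≫ (h.r ≫ h.i) ≫ Φ.map e := by simp
      _ = 𝟙 _ := by rw [← hei']; simp [hie']

/-- A direct summand is a retract. -/
theorem IsDirectSummand.nonempty_retract [HasZeroMorphisms C] [HasBinaryBiproducts C] {F E : C}
    (h : IsDirectSummand F E) : Nonempty (Retract F E) := by
  obtain ⟨G, ⟨e⟩⟩ := h
  exact ⟨⟨biprod.inl ≫ e.inv, e.hom ≫ biprod.fst, by simp⟩⟩

end Retract

/-! ### The exchange property and lifting of idempotents -/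

section Exchange

variable {C : Type u} [Category.{v} C] [Preadditive C]

/-- `M` has the exchange property: any two morphisms `a`, `b` into `M` which are jointly a split
epimorphism admit an idempotent of `M` that factors through `a` and whose complement factors
through `b`. -/
def IsExchangeObject (M : C) : Prop :=
  ∀ ⦃X Y : C⦄ (a : X ⟶ M) (b : Y ⟶ M) (c : M ⟶ X) (d : M ⟶ Y), c ≫ a + d ≫ b = 𝟙 M →
    ∃ (u : M ⟶ X) (w : M ⟶ Y), u ≫ a + w ≫ b = 𝟙 M ∧ (w ≫ b) ≫ (w ≫ b) = w ≫ b

theorem IsExchangeObject.of_isZero {M : C} (h : IsZero M) : IsExchangeObject M :=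
  fun _ _ _ _ _ _ _ => ⟨0, 0, h.eq_of_src _ _, h.eq_of_src _ _⟩

/-- The inductive step when the component of `c ≫ a` at the additional summand is invertible. -/
theorem exchange_step {M M' Y X₁ X₂ : C} (i : Y ⟶ M) (p : M ⟶ Y) (i' : M' ⟶ M) (p' : M ⟶ M')
    (hi' : i' ≫ p' = 𝟙 M') (hi'p : i' ≫ p = 0) (hsum : p ≫ i + p' ≫ i' = 𝟙 M)
    (hM' : IsExchangeObject M') (a : X₁ ⟶ M) (b : X₂ ⟶ M) (c : M ⟶ X₁) (d : M ⟶ X₂)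
    (h : c ≫ a + d ≫ b = 𝟙 M) (hiso : IsIso (i ≫ c ≫ a ≫ p)) :
    ∃ (u : M ⟶ X₁) (w : M ⟶ X₂), u ≫ a + w ≫ b = 𝟙 M ∧ (w ≫ b) ≫ (w ≫ b) = w ≫ b ∧
      (u ≫ a) ≫ (u ≫ a) = u ≫ a := by
  -- The section `g = k ≫ a` of `p` factors through `a`, so `Y`, embedded by `g`, replaces the
  -- original summand as a complement of `M'`; `ρ` is the projection onto `M'` along `g`.
  obtain ⟨k, hk⟩ : ∃ k : Y ⟶ X₁, k ≫ a ≫ p = 𝟙 Y :=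
    ⟨inv (i ≫ c ≫ a ≫ p) ≫ i ≫ c, by simp⟩
  set g : Y ⟶ M := k ≫ a with hg
  have hgp : g ≫ p = 𝟙 Y := by simpa [hg] using hk
  set ρ : M ⟶ M' := (𝟙 M - p ≫ g) ≫ p' with hρ
  have hρi : ρ ≫ i' = 𝟙 M - p ≫ g := by
    have h1 : (𝟙 M - p ≫ g) ≫ (p ≫ i + p' ≫ i') = 𝟙 M - p ≫ g := by rw [hsum, Category.comp_id]
    have h2 : (𝟙 M - p ≫ g) ≫ p = 0 := by simp [Preadditive.sub_comp, hgp]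
    rw [Preadditive.comp_add, reassoc_of% h2, zero_comp, zero_add] at h1
    rw [hρ, Category.assoc, h1]
  have hiρ : i' ≫ ρ = 𝟙 M' := by
    simp [hρ, Preadditive.sub_comp, reassoc_of% hi'p, hi']
  have key : (i' ≫ c) ≫ a ≫ ρ + (i' ≫ d) ≫ b ≫ ρ = 𝟙 M' := by
    have : i' ≫ (c ≫ a + d ≫ b) ≫ ρ = 𝟙 M' := by rw [h, Category.id_comp, hiρ]
    simpa [Preadditive.add_comp, Preadditive.comp_add] using this
  obtain ⟨u, w, huw, hw⟩ := hM' _ _ _ _ key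
  -- The two complementary idempotents of `M'` are lifted along `ρ`: `h₂` factors through `b`, `h₁`
  -- through `a`, and `h₁ + h₂` is a section of `ρ`.
  set h₂ : M' ⟶ M := (w ≫ b ≫ ρ) ≫ w ≫ b with hh₂
  have hh₂ρ : h₂ ≫ ρ = w ≫ b ≫ ρ := by simpa [hh₂] using hw
  have hidem : (ρ ≫ h₂) ≫ ρ ≫ h₂ = ρ ≫ h₂ := by
    have : h₂ ≫ ρ ≫ h₂ = h₂ := by
      rw [reassoc_of% hh₂ρ]
      have := congrArg (· ≫ w ≫ b) hw
      simpa [hh₂] using this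
    simp [this]
  set f' : M' ⟶ M' := u ≫ a ≫ ρ with hf'
  set h₁ : M' ⟶ M := f' ≫ u ≫ a with hh₁
  have hf'' : f' = 𝟙 M' - w ≫ b ≫ ρ := by rw [← huw]; simp
  have hh₁ρ : h₁ ≫ ρ = f' := by
    have : f' ≫ f' = f' := by
      rw [hf'']
      simp only [Preadditive.sub_comp, Preadditive.comp_sub, Category.id_comp, Category.comp_id,
        hw]
      simp
    simpa [hh₁, hf'] using this
  have hsumρ : (h₁ + h₂) ≫ ρ = 𝟙 M' := by
    rw [Preadditive.add_comp, hh₁ρ, hh₂ρ, hf'', sub_add_cancel]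
  -- The complement of `ρ ≫ h₂` is `ρ ≫ h₁` plus `𝟙 M - ρ ≫ (h₁ + h₂)`. The latter is killed by `ρ`,
  -- so it factors through `g`, hence through `a`.
  refine ⟨ρ ≫ f' ≫ u + ((𝟙 M - ρ ≫ (h₁ + h₂)) ≫ p) ≫ k, ρ ≫ (w ≫ b ≫ ρ) ≫ w, ?_⟩
  have e2 : (ρ ≫ (w ≫ b ≫ ρ) ≫ w) ≫ b = ρ ≫ h₂ := by simp [hh₂]
  have e1 : (ρ ≫ f' ≫ u + ((𝟙 M - ρ ≫ (h₁ + h₂)) ≫ p) ≫ k) ≫ a = 𝟙 M - ρ ≫ h₂ := by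
    have hpg : p ≫ g = 𝟙 M - ρ ≫ i' := by rw [hρi]; simp
    have : (ρ ≫ f' ≫ u + ((𝟙 M - ρ ≫ (h₁ + h₂)) ≫ p) ≫ k) ≫ a =
        ρ ≫ h₁ + (𝟙 M - ρ ≫ (h₁ + h₂)) ≫ p ≫ g := by
      simp [hh₁, hg, Preadditive.add_comp]
    rw [this, hpg]
    have h3 : (𝟙 M - ρ ≫ (h₁ + h₂)) ≫ ρ = 0 := by
      rw [Preadditive.sub_comp, Category.assoc, hsumρ]; simp
    rw [Preadditive.comp_sub, reassoc_of% h3, zero_comp, sub_zero, Category.comp_id,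
      Preadditive.comp_add]
    abel
  rw [e1, e2]
  refine ⟨sub_add_cancel _ _, hidem, ?_⟩
  rw [Preadditive.sub_comp, Preadditive.comp_sub, Preadditive.comp_sub, hidem]
  simp

/-- A direct sum of an object with local endomorphism ring and an exchange object is an exchange
object. -/
theorem IsExchangeObject.of_decomposition {M M' Y : C} [IsLocalRing (End Y)] (i : Y ⟶ M)
    (p : M ⟶ Y) (i' : M' ⟶ M) (p' : M ⟶ M') (hi : i ≫ p = 𝟙 Y) (hi' : i' ≫ p' = 𝟙 M')
    (hi'p : i' ≫ p = 0) (hsum : p ≫ i + p' ≫ i' = 𝟙 M) (hM' : IsExchangeObject M') :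
    IsExchangeObject M := by
  intro X₁ X₂ a b c d h
  have hY : End.of (i ≫ c ≫ a ≫ p) + End.of (i ≫ d ≫ b ≫ p) = 1 := by
    have : i ≫ (c ≫ a + d ≫ b) ≫ p = 𝟙 Y := by rw [h, Category.id_comp, hi]
    simpa [Preadditive.add_comp, Preadditive.comp_add] using this
  -- Locality makes one of the two components at `Y` invertible; in the second case `a` and `b` swap
  -- roles, which is why `exchange_step` makes both endomorphisms idempotent.
  rcases IsLocalRing.isUnit_or_isUnit_of_add_one hY with hu | hu
  · obtain ⟨u, w, h1, h2, -⟩ := exchange_step i p i' p' hi' hi'p hsum hM' a b c d h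
      ((isUnit_iff_isIso _).1 hu)
    exact ⟨u, w, h1, h2⟩
  · obtain ⟨w, u, h1, -, h2⟩ := exchange_step i p i' p' hi' hi'p hsum hM' b a d c
      (by rw [add_comm, h]) ((isUnit_iff_isIso _).1 hu)
    exact ⟨u, w, by rw [add_comm, h1], h2⟩

/-- A finite direct sum of objects with local endomorphism rings is an exchange object. -/
theorem IsExchangeObject.of_iso_biproduct [HasFiniteBiproducts C] (n : ℕ) :
    ∀ (M : C) (Y : Fin n → C), (∀ j, IsLocalRing (End (Y j))) → (M ≅ ⨁ Y) →
      IsExchangeObject M := by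
  induction n with
  | zero =>
    intro M Y _ e
    refine .of_isZero (IsZero.of_iso ?_ e)
    rw [IsZero.iff_id_eq_zero]
    exact biproduct.hom_ext _ _ fun j => j.elim0
  | succ n ih =>
    intro M Y hY e
    have := hY 0
    refine .of_decomposition (Y := Y 0) (M' := ⨁ fun j : Fin n => Y j.succ)
      (biproduct.ι Y 0 ≫ e.inv) (e.hom ≫ biproduct.π Y 0)
      (biproduct.desc (fun j => biproduct.ι Y j.succ) ≫ e.inv)
      (e.hom ≫ biproduct.lift fun j => biproduct.π Y j.succ) (by simp) ?_ ?_ ?_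
      (ih _ _ (fun j => hY j.succ) (Iso.refl _))
    · ext j k
      by_cases hjk : j = k
      · subst hjk; simp
      · have hkj : k ≠ j := fun h => hjk h.symm
        simp [biproduct.ι_π_ne _ hkj, biproduct.ι_π_ne Y (fun h => hkj (Fin.succ_injective _ h))]
    · ext j
      simp [biproduct.ι_π_ne Y (Fin.succ_ne_zero j)]
    · have : biproduct.π Y 0 ≫ biproduct.ι Y 0 +
          (biproduct.lift fun j : Fin n => biproduct.π Y j.succ) ≫
            biproduct.desc (fun j => biproduct.ι Y j.succ) = 𝟙 (⨁ Y) := by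
        rw [biproduct.lift_desc, ← biproduct.total, Fin.sum_univ_succ]
      calc _ = e.hom ≫ (biproduct.π Y 0 ≫ biproduct.ι Y 0 +
          (biproduct.lift fun j : Fin n => biproduct.π Y j.succ) ≫
            biproduct.desc (fun j => biproduct.ι Y j.succ)) ≫ e.inv := by
              simp [Preadditive.add_comp, Preadditive.comp_add]
        _ = 𝟙 M := by rw [this]; simp

/-- Endomorphisms of an exchange object which are idempotent modulo an ideal are congruent to
idempotents. -/
theorem IsExchangeObject.exists_idempotent {M : C} (hM : IsExchangeObject M) (e : M ⟶ M) :
    ∃ f x : M ⟶ M, f ≫ f = f ∧ e - f = x ≫ (e ≫ e - e) := by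
  -- Exchange is applied to `e` and its complement: `u ≫ e` is the idempotent, and multiplying `u ≫
  -- e + w ≫ (𝟙 M - e) = 𝟙 M` by `e` gives the congruence.
  obtain ⟨u, w, h, hw⟩ := hM e (𝟙 M - e) (𝟙 M) (𝟙 M) (by simp)
  refine ⟨u ≫ e, u - w, ?_, ?_⟩
  · have hu : u ≫ e = 𝟙 M - w ≫ (𝟙 M - e) := eq_sub_of_add_eq h
    generalize w ≫ (𝟙 M - e) = q at hu hw
    rw [hu, Preadditive.sub_comp, Preadditive.comp_sub, Preadditive.comp_sub, hw]
    simp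
  · have h' : e = u ≫ e ≫ e + w ≫ (e - e ≫ e) := by
      have := congrArg (· ≫ e) h
      simpa [Preadditive.add_comp, Preadditive.sub_comp, Preadditive.comp_sub] using this.symm
    calc e - u ≫ e = (u ≫ e ≫ e + w ≫ (e - e ≫ e)) - u ≫ e := by rw [← h']
      _ = _ := by
        simp only [Preadditive.comp_sub, Preadditive.sub_comp]
        abel

end Exchange

/-! ### Idempotents modulo an ideal, and presentations in an admissible subcategory -/

section HiltonRees

variable {A : Type u} [Category.{v} A]

theorem factorsThroughProjective_comp_left {X Y Z : A} (x : X ⟶ Y) {f : Y ⟶ Z}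
    (hf : FactorsThroughProjective f) : FactorsThroughProjective (x ≫ f) := by
  obtain ⟨Q, hQ, a, b, rfl⟩ := hf
  exact ⟨Q, hQ, x ≫ a, b, by simp⟩

theorem factorsThroughInjective_comp_left {X Y Z : A} (x : X ⟶ Y) {f : Y ⟶ Z}
    (hf : FactorsThroughInjective f) : FactorsThroughInjective (x ≫ f) := by
  obtain ⟨J, hJ, a, b, rfl⟩ := hf
  exact ⟨J, hJ, x ≫ a, b, by simp⟩

variable [Abelian A]

/-- In a Krull–Schmidt abelian category, idempotents split in the quotient of
`(⊤ : ObjectProperty A).FullSubcategory` by an ideal. -/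
theorem isIdempotentComplete_quotient (hA : IsKrullSchmidt A)
    (r : HomRel (⊤ : ObjectProperty A).FullSubcategory) [Congruence r]
    (hr : ∀ {X : (⊤ : ObjectProperty A).FullSubcategory} (e f x : X ⟶ X), r (e ≫ e) e →
      e.hom - f.hom = x.hom ≫ (e.hom ≫ e.hom - e.hom) → r e f) :
    IsIdempotentComplete (Quotient r) := by
  refine ⟨?_⟩
  rintro ⟨X⟩ p hp
  obtain ⟨e, rfl⟩ := (Quotient.functor r).map_surjective (X := X) (Y := X) p
  have he : r (e ≫ e) e := by
    rw [← Quotient.functor_map_eq_iff r]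
    exact (Functor.map_comp _ _ _).trans hp
  obtain ⟨n, Y, hY, ⟨φ⟩⟩ := hA X.obj
  have : HasFiniteBiproducts A := Abelian.hasFiniteBiproducts
  obtain ⟨f, x, hf, hx⟩ :=
    (IsExchangeObject.of_iso_biproduct n X.obj Y hY φ).exists_idempotent e.hom
  obtain ⟨Z, i, s, his, hsi⟩ := IsIdempotentComplete.idempotents_split _ f hf
  let Z' : (⊤ : ObjectProperty A).FullSubcategory := ⟨Z, trivial⟩
  let i' : Z' ⟶ X := ObjectProperty.homMk i
  let s' : X ⟶ Z' := ObjectProperty.homMk s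
  refine ⟨⟨Z'⟩, (Quotient.functor r).map i', (Quotient.functor r).map s', ?_, ?_⟩
  · refine (Functor.map_comp _ _ _).symm.trans (Eq.trans ?_ ((Quotient.functor r).map_id Z'))
    exact congrArg _ (ObjectProperty.hom_ext _ his)
  · refine (Functor.map_comp _ _ _).symm.trans ?_
    rw [eq_comm, Quotient.functor_map_eq_iff]
    refine hr e _ (ObjectProperty.homMk x) he ?_
    simpa [i', s', hsi] using hx

theorem isIdempotentComplete_stableCategory_top (hA : IsKrullSchmidt A) :
    IsIdempotentComplete (StableCategory (⊤ : ObjectProperty A)) :=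
  isIdempotentComplete_quotient hA _ fun _ _ x he h => by
    rw [stableRel, h]
    exact factorsThroughProjective_comp_left x.hom he

theorem isIdempotentComplete_costableCategory_top (hA : IsKrullSchmidt A) :
    IsIdempotentComplete (CostableCategory (⊤ : ObjectProperty A)) :=
  isIdempotentComplete_quotient hA _ fun _ _ x he h => by
    rw [costableRel, h]
    exact factorsThroughInjective_comp_left x.hom he

theorem isAdmissible_top : IsAdmissible (⊤ : ObjectProperty A) where
  iso_closed := inferInstance
  biprod_mem _ _ _ _ := trivial
  functoriallyFinite :=
    ⟨fun X => ⟨X, 𝟙 X, trivial, fun _ _ g => ⟨g, by simp⟩⟩,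
      fun X => ⟨X, 𝟙 X, trivial, fun _ _ g => ⟨g, by simp⟩⟩⟩
  projective_mem _ _ := trivial
  injective_mem _ _ := trivial
  kernel_mem _ _ _ _ _ _ := trivial
  cokernel_mem _ _ _ _ _ _ := trivial

/-- An object of an admissible subcategory is the cokernel of a monomorphism of the subcategory
with projective target. -/
theorem IsAdmissible.exists_shortExact_projective [EnoughProjectives A] {P : ObjectProperty A}
    (hP : IsAdmissible P) (X : A) (hX : P X) :
    ∃ (K Q : A) (i : K ⟶ Q) (p : Q ⟶ X) (w : i ≫ p = 0), P K ∧ Projective Q ∧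
      (ShortComplex.mk i p w).ShortExact :=
  ⟨_, _, kernel.ι (Projective.π X), Projective.π X, kernel.condition _,
    hP.kernel_mem _ _ _ inferInstance (hP.projective_mem _ inferInstance) hX, inferInstance,
    { exact := ShortComplex.exact_kernel _ }⟩

/-- An object of an admissible subcategory is the kernel of an epimorphism of the subcategory
with injective source. -/
theorem IsAdmissible.exists_shortExact_injective [EnoughInjectives A] {P : ObjectProperty A}
    (hP : IsAdmissible P) (X : A) (hX : P X) :
    ∃ (J K : A) (i : X ⟶ J) (p : J ⟶ K) (w : i ≫ p = 0), P K ∧ Injective J ∧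
      (ShortComplex.mk i p w).ShortExact :=
  ⟨_, _, Injective.ι X, cokernel.π (Injective.ι X), cokernel.condition _,
    hP.cokernel_mem _ _ _ inferInstance hX (hP.injective_mem _ inferInstance), inferInstance,
    { exact := ShortComplex.exact_cokernel _ }⟩

/-! ### The Hilton–Rees theorem on an admissible subcategory -/

section Ext

variable [HasExt.{v} A]

/-- The contravariant functor `X ↦ Ext¹(X, -)` on a full subcategory, with values in functors on
that subcategory. -/
noncomputable def restrictedExtFrom (P : ObjectProperty A) :
    P.FullSubcategory ⥤ (P.FullSubcategory ⥤ AddCommGrpCat.{v})ᵒᵖ :=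
  P.ι ⋙ (extFunctor.{v} (C := A) 1 ⋙
    (Functor.whiskeringLeft P.FullSubcategory A AddCommGrpCat.{v}).obj P.ι).rightOp

/-- The functor `X ↦ Ext¹(-, X)` on a full subcategory, with values in functors on the opposite of
that subcategory. -/
noncomputable def restrictedExtTo (P : ObjectProperty A) :
    P.FullSubcategory ⥤ (P.FullSubcategoryᵒᵖ ⥤ AddCommGrpCat.{v}) :=
  P.ι ⋙ (extFunctor.{v} (C := A) 1).flip ⋙
    (Functor.whiskeringLeft P.FullSubcategoryᵒᵖ Aᵒᵖ AddCommGrpCat.{v}).obj P.ι.op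

theorem restrictedExtFrom_map_app {P : ObjectProperty A} {X Y Z : P.FullSubcategory} (f : X ⟶ Y)
    (x : Ext.{v} Y.obj Z.obj 1) :
    ((restrictedExtFrom P).map f).unop.app Z x = (Ext.mk₀ f.hom).comp x (zero_add 1) := rfl

theorem restrictedExtTo_map_app {P : ObjectProperty A} {X Y Z : P.FullSubcategory} (f : X ⟶ Y)
    (x : Ext.{v} Z.obj X.obj 1) :
    ((restrictedExtTo P).map f).app (Opposite.op Z) x = x.comp (Ext.mk₀ f.hom) (add_zero 1) := rfl

/-- A natural transformation between the functors `Ext¹(X, -)` on a full subcategory commutes with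
composition on the right. -/
theorem app_comp_mk₀ {P : ObjectProperty A} {X Y : P.FullSubcategory}
    (α : P.ι ⋙ extFunctorObj.{v} Y.obj 1 ⟶ P.ι ⋙ extFunctorObj.{v} X.obj 1)
    {Z Z' : P.FullSubcategory} (h : Z ⟶ Z') (x : Ext.{v} Y.obj Z.obj 1) :
    (α.app Z').hom (x.comp (Ext.mk₀ h.hom) (add_zero 1)) =
      Ext.comp ((α.app Z).hom x) (Ext.mk₀ h.hom) (add_zero 1) :=
  congrArg (fun k => k.hom x) (α.naturality h)

/-- A natural transformation between the functors `Ext¹(-, X)` on a full subcategory commutes with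
composition on the left. -/
theorem app_mk₀_comp {P : ObjectProperty A} {X Y : P.FullSubcategory}
    (α : P.ι.op ⋙ (extFunctor.{v} 1).flip.obj X.obj ⟶
      P.ι.op ⋙ (extFunctor.{v} 1).flip.obj Y.obj)
    {Z Z' : P.FullSubcategory} (h : Z' ⟶ Z) (x : Ext.{v} Z.obj X.obj 1) :
    (α.app (Opposite.op Z')).hom ((Ext.mk₀ h.hom).comp x (zero_add 1)) =
      (Ext.mk₀ h.hom).comp ((α.app (Opposite.op Z)).hom x) (zero_add 1) :=
  congrArg (fun k => k.hom x) (α.naturality h.op)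

/-- A Yoneda-type argument: a transformation is determined by its value on the extension class of `K
⟶ Q ⟶ Y`. -/
theorem full_restrictedExtFrom [EnoughProjectives A] {P : ObjectProperty A}
    (hP : IsAdmissible P) : (restrictedExtFrom P).Full where
  map_surjective {X Y} α := by
    obtain ⟨K, Q, i, p, w, hK, hQ, hS⟩ := hP.exists_shortExact_projective Y.obj Y.property
    let K' : P.FullSubcategory := ⟨K, hK⟩
    let Q' : P.FullSubcategory := ⟨Q, hP.projective_mem _ hQ⟩
    let i' : K' ⟶ Q' := ObjectProperty.homMk i
    have hα := app_comp_mk₀ α.unop i' hS.extClass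
    have h0 : hS.extClass.comp (Ext.mk₀ i'.hom) (add_zero 1) = 0 := hS.extClass_comp
    rw [h0] at hα
    -- By naturality the image of the class dies in `Ext¹(X, Q)`, so it is the pullback of the class
    -- along some `X ⟶ Y`.
    obtain ⟨g, hg⟩ := Ext.covariant_sequence_exact₁ X.obj hS (α.unop.app K' hS.extClass)
      (hα.symm.trans (map_zero _)) (zero_add 1)
    obtain ⟨f, rfl⟩ := (Ext.mk₀_bijective _ _).2 g
    refine ⟨ObjectProperty.homMk f, Quiver.Hom.unop_inj ?_⟩
    ext Z x
    -- Every `x` is a pushout of the class, because `Ext¹(Q, Z) = 0`.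
    obtain ⟨h, rfl⟩ := Ext.contravariant_sequence_exact₃ hS Z.obj x
      (Ext.eq_zero_of_projective _) (add_zero 1)
    obtain ⟨h, rfl⟩ := (Ext.mk₀_bijective _ _).2 h
    refine (restrictedExtFrom_map_app _ _).trans ?_
    refine Eq.trans ?_ (app_comp_mk₀ α.unop (ObjectProperty.homMk h : K' ⟶ Z) hS.extClass).symm
    refine Eq.trans ?_ (congrArg (fun y => Ext.comp y (Ext.mk₀ h) (add_zero 1)) hg)
    exact (Ext.comp_assoc _ _ _ _ _ (by lia)).symm

/-- Dually, the class of `X ⟶ J ⟶ K` with `J` injective generates `Ext¹(-, X)`. -/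
theorem full_restrictedExtTo [EnoughInjectives A] {P : ObjectProperty A}
    (hP : IsAdmissible P) : (restrictedExtTo P).Full where
  map_surjective {X Y} α := by
    obtain ⟨J, K, i, p, w, hK, hJ, hS⟩ := hP.exists_shortExact_injective X.obj X.property
    let K' : P.FullSubcategory := ⟨K, hK⟩
    let J' : P.FullSubcategory := ⟨J, hP.injective_mem _ hJ⟩
    let p' : J' ⟶ K' := ObjectProperty.homMk p
    have hα := app_mk₀_comp α p' hS.extClass
    have h0 : (Ext.mk₀ p'.hom).comp hS.extClass (zero_add 1) = 0 := hS.comp_extClass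
    rw [h0] at hα
    obtain ⟨g, hg⟩ := Ext.contravariant_sequence_exact₃ hS Y.obj
      (α.app (Opposite.op K') hS.extClass) (hα.symm.trans (map_zero _)) (add_zero 1)
    obtain ⟨f, rfl⟩ := (Ext.mk₀_bijective _ _).2 g
    refine ⟨ObjectProperty.homMk f, ?_⟩
    ext Z x
    obtain ⟨h, rfl⟩ := Ext.covariant_sequence_exact₁ Z.unop.obj hS x
      (Ext.eq_zero_of_injective _) (zero_add 1)
    obtain ⟨h, rfl⟩ := (Ext.mk₀_bijective _ _).2 h
    refine (restrictedExtTo_map_app _ _).trans ?_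
    refine Eq.trans ?_ (app_mk₀_comp α (ObjectProperty.homMk h : Z.unop ⟶ K') hS.extClass).symm
    refine Eq.trans ?_ (congrArg (fun y => Ext.comp (Ext.mk₀ h) y (zero_add 1)) hg)
    exact Ext.comp_assoc _ _ _ _ _ (by lia)

/-- A morphism through a projective acts as zero since `Ext¹(Q, -) = 0`. Conversely, if `f` and `g`
pull the class of `K ⟶ Q ⟶ Y` back to the same element, then `f - g` lifts to `Q`. -/
theorem stableRel_iff [EnoughProjectives A] {P : ObjectProperty A} (hP : IsAdmissible P)
    {X Y : P.FullSubcategory} (f g : X ⟶ Y) :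
    stableRel P f g ↔ (restrictedExtFrom P).map f = (restrictedExtFrom P).map g := by
  constructor
  · rintro ⟨Q, hQ, a, b, h⟩
    refine Quiver.Hom.unop_inj ?_
    ext Z x
    refine (restrictedExtFrom_map_app _ _).trans
      (Eq.trans ?_ (restrictedExtFrom_map_app _ _).symm)
    change Ext.{v} Y.obj Z.obj 1 at x
    rw [← sub_add_cancel f.hom g.hom, ← h, Ext.mk₀_add, Ext.add_comp, ← Ext.mk₀_comp_mk₀_assoc,
      Ext.eq_zero_of_projective ((Ext.mk₀ b).comp _ _), Ext.comp_zero, zero_add]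
  · intro h
    obtain ⟨K, Q, i, p, w, hK, hQ, hS⟩ := hP.exists_shortExact_projective Y.obj Y.property
    let K' : P.FullSubcategory := ⟨K, hK⟩
    have h1 : (Ext.mk₀ f.hom).comp hS.extClass (zero_add 1) =
        (Ext.mk₀ g.hom).comp hS.extClass (zero_add 1) := by
      refine (restrictedExtFrom_map_app (Z := K') f _).symm.trans ?_
      rw [h]
      exact restrictedExtFrom_map_app (Z := K') g _
    obtain ⟨y, hy⟩ := Ext.covariant_sequence_exact₃ X.obj hS (Ext.mk₀ (f.hom - g.hom))
      (zero_add 1) (by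
        rw [sub_eq_add_neg, Ext.mk₀_add, Ext.mk₀_neg, Ext.add_comp, Ext.neg_comp, h1,
          add_neg_cancel])
    obtain ⟨a, rfl⟩ := (Ext.mk₀_bijective _ _).2 y
    rw [Ext.mk₀_comp_mk₀] at hy
    exact ⟨Q, hQ, a, p, (Ext.mk₀_bijective _ _).1 hy⟩

theorem costableRel_iff [EnoughInjectives A] {P : ObjectProperty A} (hP : IsAdmissible P)
    {X Y : P.FullSubcategory} (f g : X ⟶ Y) :
    costableRel P f g ↔ (restrictedExtTo P).map f = (restrictedExtTo P).map g := by
  constructor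
  · rintro ⟨J, hJ, a, b, h⟩
    ext Z x
    refine (restrictedExtTo_map_app _ _).trans
      (Eq.trans ?_ (restrictedExtTo_map_app _ _).symm)
    change Ext.{v} Z.unop.obj X.obj 1 at x
    rw [← sub_add_cancel f.hom g.hom, ← h, Ext.mk₀_add, Ext.comp_add, ← Ext.mk₀_comp_mk₀,
      ← Ext.comp_assoc _ _ _ (add_zero 1) (zero_add 0) (by lia),
      Ext.eq_zero_of_injective (Ext.comp _ (Ext.mk₀ a) _), Ext.zero_comp, zero_add]
  · intro h
    obtain ⟨J, K, i, p, w, hK, hJ, hS⟩ := hP.exists_shortExact_injective X.obj X.property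
    let K' : P.FullSubcategory := ⟨K, hK⟩
    have h1 : hS.extClass.comp (Ext.mk₀ f.hom) (add_zero 1) =
        hS.extClass.comp (Ext.mk₀ g.hom) (add_zero 1) := by
      refine (restrictedExtTo_map_app (Z := K') f _).symm.trans ?_
      rw [h]
      exact restrictedExtTo_map_app (Z := K') g _
    obtain ⟨y, hy⟩ := Ext.contravariant_sequence_exact₁ hS Y.obj (Ext.mk₀ (f.hom - g.hom))
      (add_zero 1) (by
        rw [sub_eq_add_neg, Ext.mk₀_add, Ext.mk₀_neg, Ext.comp_add, Ext.comp_neg, h1,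
          add_neg_cancel])
    obtain ⟨b, rfl⟩ := (Ext.mk₀_bijective _ _).2 y
    rw [Ext.mk₀_comp_mk₀] at hy
    exact ⟨J, hJ, i, b, (Ext.mk₀_bijective _ _).1 hy⟩

end Ext

/-! ### Representing the direct summands -/

variable [EnoughProjectives A]

theorem exists_iso_extFromRestrict {P : ObjectProperty A} (hP : IsAdmissible P)
    (h : IsIdempotentComplete (StableCategory P)) (X : A) (hX : P X)
    (F : P.FullSubcategory ⥤ AddCommGrpCat.{v}) (R : Retract F (extFromRestrict P X)) :
    ∃ B : A, P B ∧ Nonempty (F ≅ extFromRestrict P B) := by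
  have : HasExt.{v} A := hasExt_of_enoughProjectives.{v} A
  have := full_restrictedExtFrom hP
  -- `X ↦ Ext¹(X, -)` is contravariant, so the retract is read in the opposite functor category.
  have R' : Retract (Opposite.op F) ((restrictedExtFrom P).obj ⟨X, hX⟩) := R.op
  obtain ⟨B, ⟨e⟩⟩ := exists_iso_obj_of_retract (restrictedExtFrom P) (stableRel P)
    (stableRel_iff hP) R'
  exact ⟨B.obj, B.property, ⟨e.unop.symm⟩⟩

theorem exists_iso_extToRestrict [EnoughInjectives A] {P : ObjectProperty A}
    (hP : IsAdmissible P) (h : IsIdempotentComplete (CostableCategory P)) (X : A) (hX : P X)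
    (F : P.FullSubcategoryᵒᵖ ⥤ AddCommGrpCat.{v}) (R : Retract F (extToRestrict P X)) :
    ∃ B : A, P B ∧ Nonempty (F ≅ extToRestrict P B) := by
  have : HasExt.{v} A := hasExt_of_enoughProjectives.{v} A
  have := full_restrictedExtTo hP
  have R' : Retract F ((restrictedExtTo P).obj ⟨X, hX⟩) := R
  obtain ⟨B, ⟨e⟩⟩ := exists_iso_obj_of_retract (restrictedExtTo P) (costableRel P)
    (costableRel_iff hP) R'
  exact ⟨B.obj, B.property, ⟨e⟩⟩

end HiltonRees

/-- Functors that agree on `(⊤ : ObjectProperty C).FullSubcategory` are isomorphic. -/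
theorem nonempty_iso_of_ι_top_comp {C : Type*} [Category* C] {E : Type*} [Category* E]
    {F F' : C ⥤ E} (e : (⊤ : ObjectProperty C).ι ⋙ F ≅ (⊤ : ObjectProperty C).ι ⋙ F') :
    Nonempty (F ≅ F') :=
  ⟨NatIso.ofComponents (fun X => e.app ⟨X, trivial⟩)
    (fun {X Y} f => e.hom.naturality
      (ObjectProperty.homMk f : ObjectProperty.FullSubcategory.mk X trivial ⟶ ⟨Y, trivial⟩))⟩

theorem nonempty_iso_of_ι_top_op_comp {C : Type*} [Category* C] {E : Type*} [Category* E]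
    {F F' : Cᵒᵖ ⥤ E}
    (e : (⊤ : ObjectProperty C).ι.op ⋙ F ≅ (⊤ : ObjectProperty C).ι.op ⋙ F') :
    Nonempty (F ≅ F') :=
  ⟨NatIso.ofComponents (fun X => e.app (Opposite.op ⟨X.unop, trivial⟩))
    (fun {X Y} f => e.hom.naturality (ObjectProperty.homMk f.unop :
      ObjectProperty.FullSubcategory.mk Y.unop trivial ⟶ ⟨X.unop, trivial⟩).op)⟩

end AuslanderExt

theorem mainTheorem5 {A : Type u} [Category.{v} A] [Abelian A]
    [EnoughProjectives A] [EnoughInjectives A] :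
    (∀ P : ObjectProperty A, AuslanderExt.IsAdmissible P →
      (IsIdempotentComplete (AuslanderExt.StableCategory P) →
        ∀ X : A, P X → ∀ F : P.FullSubcategory ⥤ AddCommGrpCat.{v},
          AuslanderExt.IsDirectSummand F (AuslanderExt.extFromRestrict P X) →
            ∃ B : A, P B ∧ Nonempty (F ≅ AuslanderExt.extFromRestrict P B)) ∧
      (IsIdempotentComplete (AuslanderExt.CostableCategory P) →
        ∀ X : A, P X → ∀ F : P.FullSubcategoryᵒᵖ ⥤ AddCommGrpCat.{v},
          AuslanderExt.IsDirectSummand F (AuslanderExt.extToRestrict P X) →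
            ∃ B : A, P B ∧ Nonempty (F ≅ AuslanderExt.extToRestrict P B))) ∧
    (AuslanderExt.IsKrullSchmidt A →
      AuslanderExt.AuslanderConjecture A ∧ AuslanderExt.DualAuslanderConjecture A) := by
  refine ⟨fun P hP => ⟨fun h X hX F hF => ?_, fun h X hX F hF => ?_⟩, fun hA => ⟨fun X F hF => ?_, fun X F hF => ?_⟩⟩
  · obtain ⟨R⟩ := hF.nonempty_retract
    exact AuslanderExt.exists_iso_extFromRestrict hP h X hX F R
  · obtain ⟨R⟩ := hF.nonempty_retract
    exact AuslanderExt.exists_iso_extToRestrict hP h X hX F R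
  · obtain ⟨R⟩ := hF.nonempty_retract
    obtain ⟨B, -, ⟨e⟩⟩ := AuslanderExt.exists_iso_extFromRestrict AuslanderExt.isAdmissible_top
      (AuslanderExt.isIdempotentComplete_stableCategory_top hA) X trivial _
      (R.map ((Functor.whiskeringLeft _ _ _).obj (⊤ : ObjectProperty A).ι))
    exact ⟨B, AuslanderExt.nonempty_iso_of_ι_top_comp e⟩
  · obtain ⟨R⟩ := hF.nonempty_retract
    obtain ⟨B, -, ⟨e⟩⟩ := AuslanderExt.exists_iso_extToRestrict AuslanderExt.isAdmissible_top
      (AuslanderExt.isIdempotentComplete_costableCategory_top hA) X trivial _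
      (R.map ((Functor.whiskeringLeft _ _ _).obj (⊤ : ObjectProperty A).ι.op))
    exact ⟨B, AuslanderExt.nonempty_iso_of_ι_top_op_comp e⟩
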